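/- Let $R$ be a commutative ring and $A$ an (associative, unital) $R$-algebra with multiplication $(a,b)\mapsto ab$. Write $A^{op}$ for the opposite algebra and $[X,Y]=\mathrm{Hom}_R(X,Y)$, and let $(A,A)$-bimodules be those over $R$, i.e. left $A\otimes_R A^{op}$-modules. Call $A$ an Azumaya $R$-algebra if the functor $M\mapsto A\otimes_R M$, with bimodule structure $x(a\otimes m)y=xay\otimes m$, is an equivalence from the category of $R$-modules to the category of $(A,A)$-bimodules. This holds if and only if $A$ is Azumaya in the usual sense, i.e. $A$ is a finitely generated projective faithful $R$-module and $A\otimes_R A^{op}\to\mathrm{End}_R(A)$, $a\otimes b\mapsto(x\mapsto axb)$, is bijective. Call the canonical map $i:R\to A$ pure if $i\otimes_R N: R\otimes_R N\to A\otimes_R N$ is injective for every $R$-module $N$. Then for each one of the following conditions (a), (b), (c), (d): $A$ is an Azumaya $R$-algebra if and only if $i:R\to A$ is a pure morphism of $R$-modules and that condition holds. (a) For every left $A^{op}$-module $M$, the map $A\otimes_R M\to[A,M]$, $a\otimes m\mapsto\bigl(b\mapsto (ba)\cdot m\bigr)$, is an isomorphism, where $ba$ is the product in $A$, regarded as an element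 of $A^{op}$ acting on $M$. (b) For every $R$-module $N$, the map $A\otimes_R A\otimes_R N\to[A,A\otimes_R N]$, $a\otimes b\otimes n\mapsto\bigl(c\mapsto bca\otimes n\bigr)$, is an isomorphism. (c) $A$ is a finitely generated projective $R$-module and the map $A\otimes_R A\to[A,A]$, $a\otimes b\mapsto(c\mapsto bca)$, is an isomorphism. (d) For every $(A,A)$-bimodule $M$, with $M^A=\{m\in M: am=ma \text{ for all } a\in A\}$, the evaluation map $A\otimes_R M^A\to M$, $a\otimes m\mapsto a\cdot m$, is an isomorphism. -/

import Mathlib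

open scoped TensorProduct

universe u v

namespace AzumayaAlgebra

open MulOpposite

noncomputable section

/-- The canonical map `R → A` is a pure morphism of `R`-modules: it stays injective after
tensoring over `R` with an arbitrary `R`-module. -/
def UnitIsPure (R : Type u) (A : Type v) [CommRing R] [Ring A] [Algebra R A] : Prop :=
  ∀ (N : Type (max u v)) [AddCommGroup N] [Module R N],
    Function.Injective (LinearMap.rTensor N (Algebra.linearMap R A))

section Comparison

variable (R : Type u) (A : Type v) [CommRing R] [Ring A] [Algebra R A]

/-- The `A ⊗[R] Aᵐᵒᵖ`-module structure on `A ⊗[R] M` in which `x ⊗ op y` sends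
`a ⊗ m` to `(x * a * y) ⊗ m`. -/
abbrev envModule (M : Type*) [AddCommGroup M] [Module R M] :
    Module (A ⊗[R] Aᵐᵒᵖ) (A ⊗[R] M) :=
  Module.compHom (A ⊗[R] M)
    ((Module.End.rTensorAlgHom R A M).comp (AlgHom.mulLeftRight R A)).toRingHom

theorem envModule_tmul_smul_tmul (M : Type*) [AddCommGroup M] [Module R M]
    (x y a : A) (m : M) :
    letI := envModule R A M
    (x ⊗ₜ[R] op y : A ⊗[R] Aᵐᵒᵖ) • (a ⊗ₜ[R] m : A ⊗[R] M) = (x * a * y) ⊗ₜ[R] m := by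
  change ((AlgHom.mulLeftRight R A (x ⊗ₜ[R] op y)).rTensor M) (a ⊗ₜ[R] m) = _
  simp

/-- For an `R`-linear map `f`, the map `A ⊗ f` is linear over `A ⊗[R] Aᵐᵒᵖ`. -/
def envMap {M N : Type*} [AddCommGroup M] [Module R M] [AddCommGroup N] [Module R N]
    (f : M →ₗ[R] N) :
    letI := envModule R A M
    letI := envModule R A N
    A ⊗[R] M →ₗ[A ⊗[R] Aᵐᵒᵖ] A ⊗[R] N :=
  letI := envModule R A M
  letI := envModule R A N
  { toFun := f.lTensor A
    map_add' := map_add _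
    map_smul' := fun s t => by
      change (f.lTensor A) ((AlgHom.mulLeftRight R A s).rTensor M t) =
        (AlgHom.mulLeftRight R A s).rTensor N (f.lTensor A t)
      rw [← LinearMap.comp_apply, ← LinearMap.comp_apply, LinearMap.lTensor_comp_rTensor,
        LinearMap.rTensor_comp_lTensor] }

/-- The comparison functor `M ↦ A ⊗[R] M` from `R`-modules to modules over the enveloping
algebra `A ⊗[R] Aᵐᵒᵖ`, that is, to `(A, A)`-bimodules over `R`. -/
def comparison : CategoryTheory.Functor (ModuleCat.{max u v} R)
    (ModuleCat.{max u v} (A ⊗[R] Aᵐᵒᵖ)) where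
  obj M :=
    letI := envModule R A M
    ModuleCat.of (A ⊗[R] Aᵐᵒᵖ) (A ⊗[R] M)
  map {M N} f :=
    letI := envModule R A M
    letI := envModule R A N
    ModuleCat.ofHom (envMap R A f.hom)
  map_id M := by
    apply CategoryTheory.ConcreteCategory.hom_ext
    intro x
    change (LinearMap.id.lTensor A) x = x
    simp
  map_comp {M N P} f g := by
    apply CategoryTheory.ConcreteCategory.hom_ext
    intro x
    change ((g.hom ∘ₗ f.hom).lTensor A) x = (g.hom.lTensor A) (f.hom.lTensor A x)
    rw [LinearMap.lTensor_comp_apply]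

/-- `A` is an Azumaya `R`-algebra: the comparison functor from `R`-modules to
`(A, A)`-bimodules is an equivalence of categories. -/
def IsAzumayaAlgebra : Prop := (comparison R A).IsEquivalence

end Comparison

section Maps

variable (R : Type u) (A : Type v) [CommRing R] [Ring A] [Algebra R A]

/-- For a left `Aᵐᵒᵖ`-module `M`, the map `A ⊗[R] M → Hom_R(A, M)` that sends
`a ⊗ m` to `b ↦ (b * a) • m`, with `b * a` acting as an element of `Aᵐᵒᵖ`. -/
def opModuleMap (M : Type*) [AddCommGroup M] [Module R M] [Module Aᵐᵒᵖ M]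
    [IsScalarTower R Aᵐᵒᵖ M] : A ⊗[R] M →ₗ[R] (A →ₗ[R] M) :=
  TensorProduct.lift <| LinearMap.mk₂ R
    (fun a m =>
      { toFun := fun b => op (b * a) • m
        map_add' := fun b c => by rw [add_mul, op_add, add_smul]
        map_smul' := fun r b => by
          rw [smul_mul_assoc, op_smul, smul_assoc, RingHom.id_apply] })
    (fun a a' m => by ext b; simp [mul_add, add_smul])
    (fun r a m => by
      ext b
      change op (b * (r • a)) • m = r • (op (b * a) • m)
      rw [mul_smul_comm, op_smul, smul_assoc])
    (fun a m m' => by ext b; simp [smul_add])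
    (fun r a m => by
      ext b
      change op (b * a) • (r • m) = r • (op (b * a) • m)
      rw [← algebraMap_smul Aᵐᵒᵖ r m, ← algebraMap_smul Aᵐᵒᵖ r (op (b * a) • m),
        smul_smul, smul_smul, Algebra.commutes])

@[simp]
theorem opModuleMap_tmul (M : Type*) [AddCommGroup M] [Module R M] [Module Aᵐᵒᵖ M]
    [IsScalarTower R Aᵐᵒᵖ M] (a b : A) (m : M) :
    opModuleMap R A M (a ⊗ₜ[R] m) b = op (b * a) • m := rfl

/-- The map `A ⊗[R] A → Hom_R(A, A)` that sends `a ⊗ b` to `c ↦ b * c * a`. -/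
def sandwich : A ⊗[R] A →ₗ[R] (A →ₗ[R] A) :=
  TensorProduct.lift <| LinearMap.mk₂ R
    (fun a b => LinearMap.mulRight R a ∘ₗ LinearMap.mulLeft R b)
    (fun a a' b => by ext c; simp [mul_add])
    (fun r a b => by ext c; simp)
    (fun a b b' => by ext c; simp [add_mul])
    (fun r a b => by ext c; simp)

@[simp]
theorem sandwich_tmul (a b c : A) : sandwich R A (a ⊗ₜ[R] b) c = b * c * a := rfl

/-- The map `A ⊗[R] A ⊗[R] N → Hom_R(A, A ⊗[R] N)` that sends `a ⊗ b ⊗ n` to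
`c ↦ (b * c * a) ⊗ n`. -/
def freeModuleMap (N : Type*) [AddCommGroup N] [Module R N] :
    A ⊗[R] (A ⊗[R] N) →ₗ[R] (A →ₗ[R] A ⊗[R] N) :=
  TensorProduct.lift
      { toFun := fun n =>
          (LinearMap.compRight R ((TensorProduct.mk R A N).flip n)) ∘ₗ sandwich R A
        map_add' := fun n n' => by ext a b c; simp
        map_smul' := fun r n => by ext a b c; simp } ∘ₗ
    (TensorProduct.comm R (A ⊗[R] A) N).toLinearMap ∘ₗ
    (TensorProduct.assoc R A A N).symm.toLinearMap

@[simp]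
theorem freeModuleMap_tmul (N : Type*) [AddCommGroup N] [Module R N] (a b c : A) (n : N) :
    freeModuleMap R A N (a ⊗ₜ[R] (b ⊗ₜ[R] n)) c = (b * c * a) ⊗ₜ[R] n := rfl

/-- The invariants `M^A = {m | a • m = m • a for all a}` of an `(A, A)`-bimodule `M`,
where the right action of `A` on `M` is the action of `Aᵐᵒᵖ`. -/
def invariants (M : Type*) [AddCommGroup M] [Module R M] [Module A M] [Module Aᵐᵒᵖ M]
    [IsScalarTower R A M] [IsScalarTower R Aᵐᵒᵖ M] : Submodule R M where
  carrier := {m | ∀ a : A, a • m = op a • m}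
  zero_mem' := fun a => by rw [smul_zero, smul_zero]
  add_mem' := fun {m m'} h h' a => by rw [smul_add, smul_add, h a, h' a]
  smul_mem' := fun r m h a => by
    change a • (r • m) = op a • (r • m)
    have h1 : a • (r • m) = r • (a • m) := by
      rw [← algebraMap_smul A r m, ← algebraMap_smul A r (a • m), smul_smul, smul_smul,
        Algebra.commutes]
    have h2 : op a • (r • m) = r • (op a • m) := by
      rw [← algebraMap_smul Aᵐᵒᵖ r m, ← algebraMap_smul Aᵐᵒᵖ r (op a • m), smul_smul,
        smul_smul, Algebra.commutes]
    rw [h1, h2, h a]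

/-- The evaluation map `A ⊗[R] M^A → M` that sends `a ⊗ m` to `a • m`. -/
def invariantsEval (M : Type*) [AddCommGroup M] [Module R M] [Module A M] [Module Aᵐᵒᵖ M]
    [IsScalarTower R A M] [IsScalarTower R Aᵐᵒᵖ M] :
    A ⊗[R] invariants R A M →ₗ[R] M :=
  TensorProduct.lift <| LinearMap.mk₂ R
    (fun (a : A) (m : invariants R A M) => a • (m : M))
    (fun a a' m => add_smul a a' (m : M))
    (fun r a m => smul_assoc r a (m : M))
    (fun a m m' => smul_add a (m : M) (m' : M))
    (fun r a m => by
      change a • (r • (m : M)) = r • (a • (m : M))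
      rw [← algebraMap_smul A r (m : M), ← algebraMap_smul A r (a • (m : M)), smul_smul,
        smul_smul, Algebra.commutes])

@[simp]
theorem invariantsEval_tmul (M : Type*) [AddCommGroup M] [Module R M] [Module A M]
    [Module Aᵐᵒᵖ M] [IsScalarTower R A M] [IsScalarTower R Aᵐᵒᵖ M]
    (a : A) (m : invariants R A M) :
    invariantsEval R A M (a ⊗ₜ[R] m) = a • (m : M) := rfl

end Maps

end

end AzumayaAlgebra

/-! Let `E = A ⊗ Aᵐᵒᵖ` be the enveloping algebra. For `A` Azumaya, take a dual basis `(a i, f i)`.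
As `E` maps onto `End_R(A)`, each `f i`, composed with `R → A`, is the action of some `w i` in `E`.
Injectivity of `E → End_R(A)` makes the `w i` invariants of `E` with `∑ (a i ⊗ 1) * w i = 1`. They
give explicit inverses for the maps of (a) and (d) (`bijective_opModuleMap`,
`bijective_invariantsEval`); (b) is (a) for `M = A ⊗ N`. Purity holds because a faithful finitely
generated projective module has trace ideal `R`.

Conversely, an equivalence returns the same data: essential surjectivity at `E` gives the
invariants, fullness puts the centre of `A` inside the image of `R`, and
`isAzumaya_of_sum_invariants` concludes. Under purity, (d) makes `N → (A ⊗ N)^A` bijective, whence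
the equivalence. In (c), purity only supplies faithfulness.

The harder converse is (b). Surjectivity at `N = A` gives `1 ⊗ c = ∑ z j c ⊗ n j`. By purity `A` is
then finitely presented, hence `R → A` has a linear retraction `σ`, and `(n j, σ ∘ z j)` is a dual
basis (`UnitIsPure.finite_projective`). -/

namespace AzumayaAlgebra

open MulOpposite

noncomputable section

/-! ### Purity of the unit -/

section Purity

variable {R : Type u} {A : Type v} [CommRing R] [Ring A] [Algebra R A]

/-- A pure unit detects zero elements, in every module whose size is within the universe bound. -/
theorem UnitIsPure.eq_zero (h : UnitIsPure R A) {N : Type*} [AddCommGroup N] [Module R N]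
    [Small.{max u v} N] {n : N} (hn : (1 : A) ⊗ₜ[R] n = 0) : n = 0 := by
  let e : N ≃ₗ[R] Shrink.{max u v} N := (Shrink.linearEquiv R N).symm
  have h1 : (LinearMap.rTensor (Shrink.{max u v} N) (Algebra.linearMap R A)) (1 ⊗ₜ e n) = 0 := by
    rw [LinearMap.rTensor_tmul, Algebra.linearMap_apply, map_one]
    simpa using congrArg (LinearMap.lTensor A e.toLinearMap) hn
  have h2 := h (Shrink.{max u v} N) (h1.trans (map_zero _).symm)
  simpa using congrArg (TensorProduct.lid R _) h2

theorem unitIsPure_of_eq_zero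
    (h : ∀ (N : Type max u v) [AddCommGroup N] [Module R N] (n : N),
      (1 : A) ⊗ₜ[R] n = 0 → n = 0) : UnitIsPure R A := by
  intro N _ _
  rw [injective_iff_map_eq_zero]
  intro t ht
  obtain ⟨n, rfl⟩ := (TensorProduct.lid R N).symm.surjective t
  rw [TensorProduct.lid_symm_apply, LinearMap.rTensor_tmul, Algebra.linearMap_apply,
    map_one] at ht
  rw [h N n ht, map_zero]

/-- The form in which purity is mostly used: membership in a submodule is tested in the quotient
after tensoring with `A`. -/
theorem UnitIsPure.mem_of_tmul_mkQ_eq_zero (h : UnitIsPure R A) {N : Type*} [AddCommGroup N]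
    [Module R N] [Small.{max u v} N] {P : Submodule R N} {n : N}
    (hn : (1 : A) ⊗ₜ[R] P.mkQ n = 0) : n ∈ P := by
  have : Small.{max u v} (N ⧸ P) := small_of_surjective P.mkQ_surjective
  simpa using h.eq_zero hn

theorem UnitIsPure.injective_algebraMap (h : UnitIsPure R A) :
    Function.Injective (algebraMap R A) := by
  rw [injective_iff_map_eq_zero]
  intro r hr
  apply h.eq_zero
  rw [← mul_one r, ← smul_eq_mul, TensorProduct.tmul_smul, TensorProduct.smul_tmul',
    ← Algebra.algebraMap_eq_smul_one, hr, TensorProduct.zero_tmul]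

end Purity

/-! ### Dual bases and the trace ideal -/

section DualBasis

variable {R : Type u} {A : Type v} [CommRing R] [Ring A] [Algebra R A]

theorem finite_projective_of_dual_basis {n : ℕ} (a : Fin n → A) (f : Fin n → A →ₗ[R] R)
    (h : ∀ x, ∑ i, f i x • a i = x) : Module.Finite R A ∧ Module.Projective R A := by
  have hs : Fintype.linearCombination R a ∘ₗ LinearMap.pi f = LinearMap.id := by
    ext x
    simpa [Fintype.linearCombination_apply] using h x
  exact ⟨Module.Finite.of_surjective (Fintype.linearCombination R a) fun x =>
    ⟨LinearMap.pi f x, LinearMap.congr_fun hs x⟩, Module.Projective.of_split _ _ hs⟩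

theorem exists_dual_basis [Module.Finite R A] [Module.Projective R A] :
    ∃ (n : ℕ) (a : Fin n → A) (f : Fin n → A →ₗ[R] R), ∀ x, ∑ i, f i x • a i = x := by
  obtain ⟨n, p, s, -, -, hps⟩ := Module.Finite.exists_comp_eq_id_of_projective R A
  refine ⟨n, fun i => p (Pi.single i 1), fun i => LinearMap.proj i ∘ₗ s, fun x => ?_⟩
  conv_rhs => rw [← LinearMap.id_apply (R := R) x, ← hps, LinearMap.comp_apply,
    pi_eq_sum_univ' (s x), map_sum]
  simp

/-- A faithful finitely generated projective module is a generator. -/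
theorem span_dual_basis_eq_top [FaithfulSMul R A] {n : ℕ} (a : Fin n → A)
    (f : Fin n → A →ₗ[R] R) (h : ∀ x, ∑ i, f i x • a i = x) :
    Ideal.span {r | ∃ i x, f i x = r} = ⊤ := by
  have := (finite_projective_of_dual_basis a f h).1
  -- Nakayama: the dual basis gives `A = I A` for the trace ideal `I`, so some `r ≡ 1` mod `I` kills
  -- `A`; faithfulness forces `r = 0`.
  obtain ⟨r, hr, hr0⟩ := Submodule.exists_sub_one_mem_and_smul_eq_zero_of_fg_of_le_smul
    (Ideal.span {r | ∃ i x, f i x = r}) (⊤ : Submodule R A) Module.Finite.fg_top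
    (fun x _ => by
      rw [← h x]
      exact Submodule.sum_mem _ fun i _ =>
        Submodule.smul_mem_smul (Ideal.subset_span ⟨i, x, rfl⟩) trivial)
  have h0 : r = 0 := FaithfulSMul.eq_of_smul_eq_smul (α := A) fun x => by
    rw [hr0 x trivial, zero_smul]
  rw [Ideal.eq_top_iff_one]
  simpa [h0] using hr

theorem unitIsPure_of_finite_projective_faithful [Module.Finite R A] [Module.Projective R A]
    [FaithfulSMul R A] : UnitIsPure R A := by
  obtain ⟨n, a, f, h⟩ := exists_dual_basis (R := R) (A := A)
  refine unitIsPure_of_eq_zero fun N _ _ m hm => ?_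
  -- Applying `f i (x * -) ⊗ N` to `1 ⊗ m = 0` gives `f i x • m = 0`, so the trace ideal kills `m`.
  have hle : Ideal.span {r | ∃ i x, f i x = r} ≤ LinearMap.ker (LinearMap.toSpanSingleton R N m) := by
    rw [Ideal.span, Submodule.span_le]
    rintro _ ⟨i, x, rfl⟩
    have := congrArg (TensorProduct.lid R N ∘ (f i).rTensor N ∘ (LinearMap.mulLeft R x).rTensor N) hm
    simpa using this
  rw [span_dual_basis_eq_top a f h] at hle
  simpa using hle (Submodule.mem_top (x := 1))

end DualBasis

/-! ### The sandwich map and the enveloping algebra -/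

section Sandwich

variable (R : Type u) (A : Type v) [CommRing R] [Ring A] [Algebra R A]

/-- The identification of `A ⊗ A` with the enveloping algebra, exchanging the two factors. -/
def swapEnv : A ⊗[R] A ≃ₗ[R] A ⊗[R] Aᵐᵒᵖ :=
  TensorProduct.comm R A A ≪≫ₗ TensorProduct.congr (LinearEquiv.refl R A) (opLinearEquiv R)

theorem mulLeftRight_swapEnv (t : A ⊗[R] A) :
    AlgHom.mulLeftRight R A (swapEnv R A t) = sandwich R A t := by
  induction t with
  | zero => simp
  | add s t hs ht => simp [hs, ht]
  | tmul a b => ext c; simp [swapEnv]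

theorem bijective_sandwich_iff :
    Function.Bijective (sandwich R A) ↔ Function.Bijective (AlgHom.mulLeftRight R A) := by
  have : ⇑(sandwich R A) = AlgHom.mulLeftRight R A ∘ swapEnv R A :=
    funext fun t => (mulLeftRight_swapEnv R A t).symm
  rw [this, (swapEnv R A).bijective.of_comp_iff]

variable {R A}

theorem UnitIsPure.isAzumaya (h : UnitIsPure R A) (hf : Module.Finite R A)
    (hp : Module.Projective R A) (hs : Function.Bijective (sandwich R A)) : IsAzumaya R A :=
  have : FaithfulSMul R A := (faithfulSMul_iff_algebraMap_injective R A).2 h.injective_algebraMap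
  { bij := (bijective_sandwich_iff R A).1 hs }

theorem unitIsPure_of_isAzumaya [IsAzumaya R A] : UnitIsPure R A :=
  unitIsPure_of_finite_projective_faithful

/-- A dual basis of an Azumaya algebra, with its functionals realised by sandwiching. -/
theorem exists_sandwich_dual_basis [IsAzumaya R A] :
    ∃ (n : ℕ) (a : Fin n → A) (f : Fin n → A →ₗ[R] R) (w : Fin n → A ⊗[R] A),
      (∀ x, ∑ i, f i x • a i = x) ∧ ∀ i x, sandwich R A (w i) x = algebraMap R A (f i x) := by
  obtain ⟨n, a, f, h⟩ := exists_dual_basis (R := R) (A := A)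
  choose w hw using fun i => ((bijective_sandwich_iff R A).2 IsAzumaya.bij).2
    (Algebra.linearMap R A ∘ₗ f i)
  exact ⟨n, a, f, w, h, fun i x => by rw [hw]; rfl⟩

end Sandwich

/-! ### Azumaya algebras satisfy (a) -/

section OpModule

variable {R : Type u} {A : Type v} [CommRing R] [Ring A] [Algebra R A]
  {M : Type*} [AddCommGroup M] [Module R M] [Module Aᵐᵒᵖ M] [IsScalarTower R Aᵐᵒᵖ M]

/-- The orbit map `A → M`, `b ↦ m b`, of an element of a right module. -/
def rightOrbit (R : Type u) {A : Type v} [CommRing R] [Ring A] [Algebra R A]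
    {M : Type*} [AddCommGroup M] [Module R M] [Module Aᵐᵒᵖ M] [IsScalarTower R Aᵐᵒᵖ M] :
    M →+ (A →ₗ[R] M) where
  toFun m :=
    { toFun := fun b => op b • m
      map_add' := fun b c => by rw [op_add, add_smul]
      map_smul' := fun r b => by rw [op_smul, smul_assoc, RingHom.id_apply] }
  map_zero' := by ext; simp
  map_add' m m' := by ext; simp

theorem rightOrbit_apply (m : M) (b : A) : rightOrbit R m b = op b • m := rfl

/-- Transports sandwich identities in `A ⊗ A` to an arbitrary right module along the orbit map of
`m`. -/
theorem opModuleMap_lTensor_rightOrbit (m : M) (t : A ⊗[R] A) (c : A) :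
    opModuleMap R A M ((rightOrbit R m).lTensor A t) c = op (sandwich R A t c) • m := by
  induction t with
  | zero => simp
  | add s t hs ht => simp only [map_add, LinearMap.add_apply, hs, ht, op_add, add_smul]
  | tmul a b =>
    rw [LinearMap.lTensor_tmul, opModuleMap_tmul, sandwich_tmul, rightOrbit_apply, smul_smul,
      ← op_mul, mul_assoc]

theorem rightOrbit_smul (m : M) (x : A) :
    rightOrbit R (op x • m) = rightOrbit R m ∘ₗ LinearMap.mulLeft R x := by
  ext b
  simp [rightOrbit_apply, smul_smul]

theorem sandwich_lTensor_mulLeft (x c : A) (t : A ⊗[R] A) :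
    sandwich R A ((LinearMap.mulLeft R x).lTensor A t) c = x * sandwich R A t c := by
  induction t with
  | zero => simp
  | add s t hs ht => simp only [map_add, LinearMap.add_apply, hs, ht, mul_add]
  | tmul a b => simp [mul_assoc]

variable (M) in
theorem bijective_opModuleMap [IsAzumaya R A] : Function.Bijective (opModuleMap R A M) := by
  obtain ⟨n, a, f, w, h, hw⟩ := exists_sandwich_dual_basis (R := R) (A := A)
  -- By injectivity of the sandwich map it suffices that both sides act as `c ↦ c * x`, which is the
  -- dual basis expansion of `c`.
  have key (x : A) : ∑ i, (LinearMap.mulLeft R (a i * x)).lTensor A (w i) = x ⊗ₜ 1 := by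
    apply ((bijective_sandwich_iff R A).2 IsAzumaya.bij).1
    ext c
    rw [map_sum, LinearMap.sum_apply]
    simp only [sandwich_lTensor_mulLeft, hw, sandwich_tmul, one_mul]
    conv_rhs => rw [← h c, Finset.sum_mul]
    refine Finset.sum_congr rfl fun i _ => ?_
    rw [← Algebra.commutes, Algebra.smul_def, mul_assoc]
  refine Function.bijective_iff_has_inverse.2
    ⟨fun φ => ∑ i, (rightOrbit R (φ (a i))).lTensor A (w i), fun t => ?_, fun φ => ?_⟩
  · induction t with
    | zero => simp
    | add s t hs ht =>
      simp only [map_add, LinearMap.add_apply, LinearMap.lTensor_add, Finset.sum_add_distrib]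
        at hs ht ⊢
      rw [hs, ht]
    | tmul x m =>
      simp only [opModuleMap_tmul, rightOrbit_smul, LinearMap.lTensor_comp_apply]
      rw [← map_sum, key, LinearMap.lTensor_tmul, rightOrbit_apply, op_one, one_smul]
  · ext c
    simp only [map_sum, LinearMap.sum_apply, opModuleMap_lTensor_rightOrbit, hw]
    conv_rhs => rw [← h c, map_sum]
    refine Finset.sum_congr rfl fun i _ => ?_
    rw [map_smul, ← MulOpposite.algebraMap_apply, algebraMap_smul]

theorem opModuleMap_eq_freeModuleMap (N : Type*) [AddCommGroup N] [Module R N] :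
    opModuleMap R A (A ⊗[R] N) = freeModuleMap R A N := by
  ext a b n c
  simp [TensorProduct.smul_tmul', mul_assoc]

end OpModule

/-! ### Azumaya algebras satisfy (d) -/

section Invariants

variable {R : Type u} {A : Type v} [CommRing R] [Ring A] [Algebra R A]
  {M : Type*} [AddCommGroup M] [Module R M] [Module A M] [Module Aᵐᵒᵖ M]
  [IsScalarTower R A M] [IsScalarTower R Aᵐᵒᵖ M] [SMulCommClass A Aᵐᵒᵖ M]

/-- For invariant `z` the map `a ↦ a • z` is a bimodule map from `A`, since right multiplication
passes `a` and becomes left multiplication on `z`. -/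
theorem env_smul_smul_invariants [Module (A ⊗[R] Aᵐᵒᵖ) M]
    (hM : ∀ (x : A) (y : Aᵐᵒᵖ) (m : M), (x ⊗ₜ[R] y : A ⊗[R] Aᵐᵒᵖ) • m = x • y • m)
    (s : A ⊗[R] Aᵐᵒᵖ) (a : A) {z : M} (hz : z ∈ invariants R A M) :
    s • a • z = (AlgHom.mulLeftRight R A s a) • z := by
  induction s with
  | zero => exact (zero_smul (A ⊗[R] Aᵐᵒᵖ) (a • z)).trans (by simp)
  | add s t hs ht => simp only [map_add, LinearMap.add_apply, add_smul, hs, ht]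
  | tmul x y =>
    rw [hM, AlgHom.mulLeftRight_apply, ← smul_comm a y z,
      ← op_unop y, ← hz, smul_smul, smul_smul, unop_op]

theorem invariantsEval_env_smul [Module (A ⊗[R] Aᵐᵒᵖ) M]
    (hM : ∀ (x : A) (y : Aᵐᵒᵖ) (m : M), (x ⊗ₜ[R] y : A ⊗[R] Aᵐᵒᵖ) • m = x • y • m)
    (s : A ⊗[R] Aᵐᵒᵖ) (t : A ⊗[R] invariants R A M) :
    invariantsEval R A M ((AlgHom.mulLeftRight R A s).rTensor _ t) =
      s • invariantsEval R A M t := by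
  induction t with
  | zero => simp
  | add t t' ht ht' => rw [map_add, map_add, ht, ht', map_add, smul_add]
  | tmul a m =>
    rw [invariantsEval_tmul, env_smul_smul_invariants hM s a m.2]
    rfl

attribute [local instance] TensorProduct.Algebra.module

theorem env_smul_mem_invariants {w : A ⊗[R] Aᵐᵒᵖ} (hw : ∀ a : A, (a ⊗ₜ 1) * w = (1 ⊗ₜ op a) * w)
    (m : M) : w • m ∈ invariants R A M := by
  intro a
  have := congrArg (· • m) (hw a)
  simpa [mul_smul, TensorProduct.Algebra.smul_def] using this

variable (M) in
theorem bijective_invariantsEval [IsAzumaya R A] :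
    Function.Bijective (invariantsEval R A M) := by
  obtain ⟨n, a, f, w', h, hw'⟩ := exists_sandwich_dual_basis (R := R) (A := A)
  let w := fun i => swapEnv R A (w' i)
  have hw (i x) : AlgHom.mulLeftRight R A (w i) x = algebraMap R A (f i x) := by
    rw [mulLeftRight_swapEnv, hw']
  -- Both products act on `A` alike, because `w i` takes values in the image of `R`, which is
  -- central.
  have hinv (i) (m : M) : w i • m ∈ invariants R A M :=
    env_smul_mem_invariants (fun x => IsAzumaya.bij.1 <| by
      ext c
      simp [hw, Algebra.commutes]) m
  have hone : ∑ i, (a i ⊗ₜ 1) * w i = 1 := IsAzumaya.bij.1 <| by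
    ext c
    rw [map_sum, LinearMap.sum_apply, map_one, Module.End.one_apply]
    conv_rhs => rw [← h c]
    refine Finset.sum_congr rfl fun i _ => ?_
    simp [hw, Algebra.smul_def, Algebra.commutes]
  refine Function.bijective_iff_has_inverse.2
    ⟨fun m => ∑ i, a i ⊗ₜ ⟨w i • m, hinv i m⟩, fun t => ?_, fun m => ?_⟩
  · induction t with
    | zero =>
      refine Finset.sum_eq_zero fun i _ => ?_
      have hz : (⟨w i • invariantsEval R A M 0, hinv i _⟩ : invariants R A M) = 0 :=
        Subtype.ext ((congrArg (w i • ·) (map_zero _)).trans (smul_zero _))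
      rw [hz, TensorProduct.tmul_zero]
    | add s t hs ht =>
      conv_rhs => rw [← hs, ← ht]
      dsimp only
      rw [← Finset.sum_add_distrib]
      refine Finset.sum_congr rfl fun i _ => ?_
      rw [← TensorProduct.tmul_add]
      congr 1
      ext
      simp
    | tmul x z =>
      conv_rhs => rw [← h x, TensorProduct.sum_tmul]
      refine Finset.sum_congr rfl fun i _ => ?_
      rw [TensorProduct.smul_tmul]
      congr 1
      refine Subtype.ext ((env_smul_smul_invariants (fun _ _ _ =>
        TensorProduct.Algebra.smul_def _ _ _) (w i) x z.2).trans ?_)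
      rw [hw, algebraMap_smul]
      rfl
  · conv_rhs => rw [← one_smul (A ⊗[R] Aᵐᵒᵖ) m, ← hone, Finset.sum_smul]
    rw [map_sum]
    refine Finset.sum_congr rfl fun i _ => ?_
    rw [mul_smul, TensorProduct.Algebra.smul_def, one_smul, invariantsEval_tmul]

end Invariants

/-! ### From purity and (b) to a finite projective algebra -/

section Descent

variable {R : Type u} {A : Type v} [CommRing R] [Ring A] [Algebra R A]

/-- A finite linear system over `R` which is solvable in `A` is solvable in `R`, when the unit
is pure. -/
theorem UnitIsPure.exists_mulVec_eq (h : UnitIsPure R A) {ι κ : Type} [Fintype ι] [Fintype κ]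
    (V : Matrix ι κ R) (y : ι → R) (a : κ → A)
    (hV : ∀ i, ∑ k, V i k • a k = algebraMap R A (y i)) : ∃ s, V.mulVec s = y := by
  classical
  suffices y ∈ LinearMap.range V.mulVecLin from this
  have hVk (k : κ) : V.mulVecLin (Pi.single k 1) = ∑ i, V i k • (Pi.single i 1 : ι → R) := by
    ext i
    simp [Finset.sum_apply, Pi.single_apply]
  -- The solution in `A` writes `1 ⊗ y` through columns of `V`, so `1 ⊗ y` vanishes in `A ⊗ coker V`
  -- and purity applies.
  have hker : ∑ k, a k ⊗ₜ[R] V.mulVecLin (Pi.single k 1) = (1 : A) ⊗ₜ[R] y := by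
    conv_rhs => rw [pi_eq_sum_univ' y, TensorProduct.tmul_sum]
    simp only [hVk, TensorProduct.tmul_sum]
    rw [Finset.sum_comm]
    refine Finset.sum_congr rfl fun i _ => ?_
    rw [TensorProduct.tmul_smul, TensorProduct.smul_tmul', ← Algebra.algebraMap_eq_smul_one,
      ← hV, TensorProduct.sum_tmul]
    exact Finset.sum_congr rfl fun k _ => by rw [TensorProduct.tmul_smul, TensorProduct.smul_tmul']
  apply h.mem_of_tmul_mkQ_eq_zero
  rw [← LinearMap.lTensor_tmul, ← hker, map_sum]
  refine Finset.sum_eq_zero fun k _ => ?_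
  rw [LinearMap.lTensor_tmul, Submodule.mkQ_apply,
    (Submodule.Quotient.mk_eq_zero _).2 (LinearMap.mem_range_self _ _), TensorProduct.tmul_zero]

section

variable (h : UnitIsPure R A) {k : ℕ} (n : Fin k → A) (z : Fin k → A →ₗ[R] A)
  (hz : ∀ c, ∑ j, z j c ⊗ₜ[R] n j = (1 : A) ⊗ₜ[R] c)

include h hz

theorem UnitIsPure.span_eq_top : Submodule.span R (Set.range n) = ⊤ := by
  rw [eq_top_iff]
  intro c _
  apply h.mem_of_tmul_mkQ_eq_zero
  rw [← LinearMap.lTensor_tmul, ← hz c, map_sum]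
  refine Finset.sum_eq_zero fun j _ => ?_
  rw [LinearMap.lTensor_tmul, Submodule.mkQ_apply,
    (Submodule.Quotient.mk_eq_zero _).2 (Submodule.subset_span (Set.mem_range_self j)), TensorProduct.tmul_zero]

/-- The map `D` takes values in the image of `A ⊗ ker p` and equals `x ↦ 1 ⊗ x` on `ker p`. The
finitely many `D (Pi.single i 1)` involve finitely many elements of `ker p`; by purity these span
it. -/
theorem UnitIsPure.fg_ker_linearCombination :
    (LinearMap.ker (Fintype.linearCombination R n)).FG := by
  classical
  set p := Fintype.linearCombination R n with hp
  have hsurj : Function.Surjective p := by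
    rw [← LinearMap.range_eq_top, hp, Fintype.range_linearCombination, h.span_eq_top n z hz]
  let D : (Fin k → R) →ₗ[R] A ⊗[R] (Fin k → R) :=
    TensorProduct.mk R A _ 1 -
      ∑ j, (TensorProduct.mk R A (Fin k → R)).flip (Pi.single j 1) ∘ₗ z j ∘ₗ p
  have hD (x) : D x = 1 ⊗ₜ x - ∑ j, z j (p x) ⊗ₜ Pi.single j 1 := by
    simp [D, LinearMap.sum_apply]
  have hpD (x) : p.lTensor A (D x) = 0 := by
    rw [hD, map_sub, map_sum]
    simp only [LinearMap.lTensor_tmul]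
    rw [← hz (p x), sub_eq_zero]
    simp [hp]
  choose s hs using fun i : Fin k =>
    (lTensor_exact A (LinearMap.exact_subtype_ker_map p) hsurj (D (Pi.single i 1))).1 (hpD _)
  choose m a l hl using fun i => TensorProduct.exists_sum_tmul_eq (s i)
  let L' : Submodule R (Fin k → R) :=
    ⨆ i, Submodule.span R (Set.range fun j => (l i j : Fin k → R))
  have hL' (i j) : (l i j : Fin k → R) ∈ L' :=
    Submodule.mem_iSup_of_mem i (Submodule.subset_span ⟨j, rfl⟩)
  have hle : L' ≤ LinearMap.ker p := iSup_le fun i => Submodule.span_le.2 <| by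
    rintro _ ⟨j, rfl⟩
    exact (l i j).2
  have hzero : L'.mkQ.lTensor A ∘ₗ D = 0 := by
    refine LinearMap.pi_ext' fun i => LinearMap.ext_ring ?_
    rw [LinearMap.comp_apply, LinearMap.comp_apply, LinearMap.single_apply, ← hs, hl, map_sum,
      map_sum]
    refine Finset.sum_eq_zero fun j _ => ?_
    rw [LinearMap.lTensor_tmul, LinearMap.lTensor_tmul, Submodule.mkQ_apply,
      Submodule.subtype_apply, (Submodule.Quotient.mk_eq_zero _).2 (hL' i j),
      TensorProduct.tmul_zero]
  have heq : LinearMap.ker p = L' := by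
    refine le_antisymm (fun x hx => h.mem_of_tmul_mkQ_eq_zero ?_) hle
    have := LinearMap.congr_fun hzero x
    rw [LinearMap.comp_apply, hD, LinearMap.mem_ker.1 hx] at this
    simpa using this
  rw [heq]
  exact Submodule.fg_iSup _ fun i => Submodule.fg_span (Set.finite_range _)

theorem UnitIsPure.exists_retraction : ∃ σ : A →ₗ[R] R, σ 1 = 1 := by
  set p := Fintype.linearCombination R n with hp
  have hsurj : Function.Surjective p := by
    rw [← LinearMap.range_eq_top, hp, Fintype.range_linearCombination, h.span_eq_top n z hz]
  obtain ⟨m, l, hl⟩ := Submodule.fg_iff_exists_fin_generating_family.1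
    (h.fg_ker_linearCombination n z hz)
  obtain ⟨ρ, hρ⟩ := hsurj 1
  -- A retraction is a functional `s` on `R^k` that kills the generators `l j` of `ker p` and is `1`
  -- on a lift `ρ` of `1`. This finite system has the solution `n` in `A`, hence one in `R`.
  obtain ⟨s, hs⟩ := h.exists_mulVec_eq
    (Matrix.of (Sum.elim l fun _ : Unit => ρ)) (Sum.elim 0 1) n (by
      rintro (j | j)
      · have : l j ∈ LinearMap.ker p := hl ▸ Submodule.subset_span ⟨j, rfl⟩
        simpa [hp, Fintype.linearCombination_apply] using this
      · simpa [hp, Fintype.linearCombination_apply] using hρ)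
  let τ : (Fin k → R) →ₗ[R] R := Fintype.linearCombination R s
  have hτ : LinearMap.ker p ≤ LinearMap.ker τ := by
    rw [← hl, Submodule.span_le]
    rintro _ ⟨j, rfl⟩
    simpa [τ, Fintype.linearCombination_apply, Matrix.mulVec, dotProduct] using
      congrFun hs (Sum.inl j)
  refine ⟨(LinearMap.ker p).liftQ τ hτ ∘ₗ (p.quotKerEquivOfSurjective hsurj).symm, ?_⟩
  have h1 : (p.quotKerEquivOfSurjective hsurj).symm 1 = (LinearMap.ker p).mkQ ρ := by
    rw [LinearEquiv.symm_apply_eq, ← hρ]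
    rfl
  rw [LinearMap.comp_apply, LinearEquiv.coe_coe, h1, Submodule.mkQ_apply, Submodule.liftQ_apply]
  simpa [τ, Fintype.linearCombination_apply, Matrix.mulVec, dotProduct] using
      congrFun hs (Sum.inr ())

theorem UnitIsPure.finite_projective : Module.Finite R A ∧ Module.Projective R A := by
  obtain ⟨σ, hσ⟩ := h.exists_retraction n z hz
  refine finite_projective_of_dual_basis n (fun j => σ ∘ₗ z j) fun x => ?_
  -- Applying `σ` to the left factor of `hz` gives the dual basis identity.
  have := congrArg (TensorProduct.lid R A ∘ σ.rTensor A) (hz x)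
  simpa [hσ] using this

end

theorem freeModuleMap_assoc_tmul {N : Type*} [AddCommGroup N] [Module R N] (t : A ⊗[R] A) (n : N)
    (c : A) :
    freeModuleMap R A N (TensorProduct.assoc R A A N (t ⊗ₜ n)) c = sandwich R A t c ⊗ₜ n := by
  simp [freeModuleMap]

theorem exists_sum_tmul_of_surjective_freeModuleMap
    (hb : Function.Surjective (freeModuleMap R A (ULift.{u} A))) :
    ∃ (k : ℕ) (n : Fin k → A) (z : Fin k → A →ₗ[R] A),
      ∀ c, ∑ j, z j c ⊗ₜ[R] n j = (1 : A) ⊗ₜ[R] c := by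
  -- `t` is a preimage of the map `c ↦ 1 ⊗ c`.
  obtain ⟨t, ht⟩ := hb (TensorProduct.mk R A _ 1 ∘ₗ ULift.moduleEquiv.symm.toLinearMap)
  obtain ⟨t, rfl⟩ := (TensorProduct.assoc R A A _).surjective t
  obtain ⟨k, w, n, rfl⟩ := TensorProduct.exists_sum_tmul_eq t
  refine ⟨k, fun j => (n j).down, fun j => sandwich R A (w j), fun c => ?_⟩
  have := congrArg (ULift.moduleEquiv.toLinearMap.lTensor A) (LinearMap.congr_fun ht c)
  simpa [map_sum, LinearMap.sum_apply, freeModuleMap_assoc_tmul] using this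

theorem bijective_sandwich_of_freeModuleMap
    (hb : Function.Bijective (freeModuleMap R A (ULift.{v} R))) :
    Function.Bijective (sandwich R A) := by
  let e : A ≃ₗ[R] A ⊗[R] ULift.{v} R := (TensorProduct.rid R A).symm ≪≫ₗ
    TensorProduct.congr (LinearEquiv.refl R A) ULift.moduleEquiv.symm
  have he (t : A ⊗[R] A) : freeModuleMap R A (ULift.{v} R)
      (TensorProduct.congr (LinearEquiv.refl R A) e t) = e.congrRight (sandwich R A t) := by
    induction t with
    | zero => simp
    | add s t hs ht => simp only [map_add, hs, ht]
    | tmul a b =>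
      ext c
      change _ = e (b * c * a)
      simp [e]
  rw [← Function.Bijective.of_comp_iff' e.congrRight.bijective]
  exact (funext he : _ = e.congrRight ∘ sandwich R A) ▸ hb.comp (LinearEquiv.bijective _)

theorem UnitIsPure.isAzumaya_of_freeModuleMap (h : UnitIsPure R A)
    (hb : ∀ (N : Type max u v) [AddCommGroup N] [Module R N],
      Function.Bijective (freeModuleMap R A N)) : IsAzumaya R A := by
  obtain ⟨k, n, z, hz⟩ := exists_sum_tmul_of_surjective_freeModuleMap (hb (ULift.{u} A)).2
  obtain ⟨hf, hp⟩ := h.finite_projective n z hz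
  exact h.isAzumaya hf hp (bijective_sandwich_of_freeModuleMap (hb (ULift.{v} R)))

end Descent

/-! ### Invariants of `A ⊗ N` and bimodule maps -/

section BimoduleMaps

variable {R : Type u} {A : Type v} [CommRing R] [Ring A] [Algebra R A]

theorem one_tmul_mem_invariants {N : Type*} [AddCommGroup N] [Module R N] (n : N) :
    (1 : A) ⊗ₜ[R] n ∈ invariants R A (A ⊗[R] N) := fun a => by
  simp [TensorProduct.smul_tmul']

/-- The map `N → (A ⊗ N)^A`, `n ↦ 1 ⊗ n`. -/
def toInvariants (R : Type u) (A : Type v) [CommRing R] [Ring A] [Algebra R A]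
    (N : Type*) [AddCommGroup N] [Module R N] : N →ₗ[R] invariants R A (A ⊗[R] N) :=
  (TensorProduct.mk R A N 1).codRestrict _ one_tmul_mem_invariants

theorem invariantsEval_lTensor_toInvariants {N : Type*} [AddCommGroup N] [Module R N]
    (t : A ⊗[R] N) : invariantsEval R A (A ⊗[R] N) ((toInvariants R A N).lTensor A t) = t := by
  induction t with
  | zero => simp
  | add s t hs ht => rw [map_add, map_add, hs, ht]
  | tmul a n =>
    rw [LinearMap.lTensor_tmul, invariantsEval_tmul]
    change a • ((1 : A) ⊗ₜ[R] n) = _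
    rw [TensorProduct.smul_tmul', smul_eq_mul, mul_one]

theorem UnitIsPure.mem_range_of_lTensor_eq (h : UnitIsPure R A) {N M : Type*} [AddCommGroup N]
    [Module R N] [AddCommGroup M] [Module R M] [Small.{max u v} M] {Q : Submodule R M}
    (J : N →ₗ[R] Q) {s : A ⊗[R] N} {t : Q} (hs : J.lTensor A s = (1 : A) ⊗ₜ t) :
    t ∈ LinearMap.range J := by
  have : Small.{max u v} Q := small_of_injective Subtype.val_injective
  apply h.mem_of_tmul_mkQ_eq_zero
  rw [← LinearMap.lTensor_tmul, ← hs, ← LinearMap.lTensor_comp_apply, LinearMap.range_mkQ_comp,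
    LinearMap.lTensor_zero, LinearMap.zero_apply]

/-- For surjectivity, an invariant `t` of `A ⊗ N` gives two elements of `A ⊗ (A ⊗ N)^A`: its image
under `A ⊗ toInvariants`, and `1 ⊗ t`. Both evaluate to `t`, so they agree, and purity puts `t` in
the range. -/
theorem UnitIsPure.bijective_toInvariants (h : UnitIsPure R A) (N : Type max u v)
    [AddCommGroup N] [Module R N]
    (hd : Function.Injective (invariantsEval R A (A ⊗[R] N))) :
    Function.Bijective (toInvariants R A N) := by
  constructor
  · rw [injective_iff_map_eq_zero]
    intro n hn
    exact h.eq_zero (congrArg Subtype.val hn)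
  · refine fun t => h.mem_range_of_lTensor_eq (toInvariants R A N) (s := t) (hd ?_)
    rw [invariantsEval_lTensor_toInvariants, invariantsEval_tmul, one_smul]

/-- A bimodule map sends `1 ⊗ n` to an invariant, which has the form `1 ⊗ g n`. -/
theorem exists_lTensor_eq {N N' : Type*} [AddCommGroup N] [Module R N] [AddCommGroup N']
    [Module R N'] (h : Function.Bijective (toInvariants R A N'))
    (φ : A ⊗[R] N →+ A ⊗[R] N') (hl : ∀ (a : A) t, φ (a • t) = a • φ t)
    (hr : ∀ (a : A) t, φ (op a • t) = op a • φ t) :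
    ∃ g : N →ₗ[R] N', ∀ t, g.lTensor A t = φ t := by
  let ψ : N →ₗ[R] invariants R A (A ⊗[R] N') :=
    { toFun := fun n => ⟨φ (1 ⊗ₜ n), fun a => by
        rw [← hl, ← hr, one_tmul_mem_invariants]⟩
      map_add' := fun m n => Subtype.ext (by simp [TensorProduct.tmul_add])
      map_smul' := fun r n => Subtype.ext <| by
        change φ (1 ⊗ₜ (r • n)) = r • φ (1 ⊗ₜ n)
        rw [TensorProduct.tmul_smul, ← algebraMap_smul A r, hl, algebraMap_smul] }
  let e := LinearEquiv.ofBijective (toInvariants R A N') h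
  have he (n : N) : (1 : A) ⊗ₜ[R] e.symm (ψ n) = φ (1 ⊗ₜ n) :=
    congrArg Subtype.val (e.apply_symm_apply (ψ n))
  refine ⟨e.symm.toLinearMap ∘ₗ ψ, fun t => ?_⟩
  induction t with
  | zero => simp
  | add s t hs ht => rw [map_add, map_add, hs, ht]
  | tmul a n =>
    have h1 {X : Type _} [AddCommGroup X] [Module R X] (x : X) :
        a ⊗ₜ[R] x = a • ((1 : A) ⊗ₜ[R] x) := by
      rw [TensorProduct.smul_tmul', smul_eq_mul, mul_one]
    rw [LinearMap.lTensor_tmul, h1 n, hl, ← he, TensorProduct.smul_tmul', smul_eq_mul, mul_one]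
    rfl

end BimoduleMaps

/-! ### Purity and (d) give the equivalence -/

section Comparison

variable {R : Type u} {A : Type v} [CommRing R] [Ring A] [Algebra R A]

theorem envModule_smul (M : Type*) [AddCommGroup M] [Module R M] (x y : A) (t : A ⊗[R] M) :
    letI := envModule R A M
    (x ⊗ₜ[R] op y : A ⊗[R] Aᵐᵒᵖ) • t = x • op y • t := by
  let _ := envModule R A M
  induction t with
  | zero => simp
  | add s t hs ht => simp only [smul_add, hs, ht]
  | tmul a m =>
    rw [envModule_tmul_smul_tmul, TensorProduct.smul_tmul', TensorProduct.smul_tmul', op_smul_eq_mul,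
      smul_eq_mul, mul_assoc]

theorem UnitIsPure.faithful_comparison (h : UnitIsPure R A) : (comparison R A).Faithful where
  map_injective {M N f g} hfg := by
    ext n
    have h1 : (1 : A) ⊗ₜ[R] f.hom n = 1 ⊗ₜ g.hom n :=
      CategoryTheory.ConcreteCategory.congr_hom hfg ((1 : A) ⊗ₜ[R] n)
    rw [← sub_eq_zero]
    apply h.eq_zero
    rw [TensorProduct.tmul_sub, h1, sub_self]

theorem full_comparison
    (h : ∀ (N : Type max u v) [AddCommGroup N] [Module R N],
      Function.Bijective (toInvariants R A N)) : (comparison R A).Full where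
  map_surjective {M N} φ := by
    let _ := envModule R A M
    let _ := envModule R A N
    let φ' : A ⊗[R] M →ₗ[A ⊗[R] Aᵐᵒᵖ] A ⊗[R] N := φ.hom
    have hφ (x y : A) (t : A ⊗[R] M) : φ' (x • op y • t) = x • op y • φ' t := by
      rw [← envModule_smul, ← envModule_smul, map_smul]
    obtain ⟨g, hg⟩ := exists_lTensor_eq (h N) φ'.toAddMonoidHom
      (fun a t => by simpa using hφ a 1 t) (fun a t => by simpa using hφ 1 a t)
    refine ⟨ModuleCat.ofHom g, ?_⟩
    apply CategoryTheory.ConcreteCategory.hom_ext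
    exact hg

theorem essSurj_comparison
    (h : ∀ (M : Type (max u v)) [AddCommGroup M] [Module R M] [Module A M] [Module Aᵐᵒᵖ M]
        [IsScalarTower R A M] [IsScalarTower R Aᵐᵒᵖ M] [SMulCommClass A Aᵐᵒᵖ M],
        Function.Bijective (invariantsEval R A M)) : (comparison R A).EssSurj where
  mem_essImage M := by
    let _ : Module R M := Module.compHom M (algebraMap R (A ⊗[R] Aᵐᵒᵖ))
    let _ : Module A M := Module.compHom M
      (Algebra.TensorProduct.includeLeft : A →ₐ[R] A ⊗[R] Aᵐᵒᵖ).toRingHom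
    let _ : Module Aᵐᵒᵖ M := Module.compHom M
      (Algebra.TensorProduct.includeRight : Aᵐᵒᵖ →ₐ[R] A ⊗[R] Aᵐᵒᵖ).toRingHom
    have hR (r : R) (m : M) : r • m = algebraMap R (A ⊗[R] Aᵐᵒᵖ) r • m := rfl
    have hA (a : A) (m : M) : a • m = (a ⊗ₜ[R] (1 : Aᵐᵒᵖ)) • m := rfl
    have hAop (a : Aᵐᵒᵖ) (m : M) : a • m = ((1 : A) ⊗ₜ[R] a) • m := rfl
    have : IsScalarTower R A M := ⟨fun r a m => by
      rw [hR, hA, hA, ← mul_smul, ← Algebra.smul_def, TensorProduct.smul_tmul']⟩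
    have : IsScalarTower R Aᵐᵒᵖ M := ⟨fun r a m => by
      rw [hR, hAop, hAop, ← mul_smul, ← Algebra.smul_def, TensorProduct.tmul_smul]⟩
    have : SMulCommClass A Aᵐᵒᵖ M := ⟨fun a b m => by
      simp only [hA, hAop, ← mul_smul, Algebra.TensorProduct.tmul_mul_tmul, one_mul, mul_one]⟩
    let _ := envModule R A (invariants R A M)
    let e : A ⊗[R] invariants R A M ≃ₗ[A ⊗[R] Aᵐᵒᵖ] M := LinearEquiv.ofBijective
      { toFun := invariantsEval R A M
        map_add' := map_add _
        map_smul' := invariantsEval_env_smul fun x y m => by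
          rw [hA, hAop, ← mul_smul, Algebra.TensorProduct.tmul_mul_tmul, one_mul, mul_one] } (h M)
    exact ⟨ModuleCat.of R (invariants R A M), ⟨e.toModuleIso⟩⟩

theorem UnitIsPure.isAzumayaAlgebra (hi : UnitIsPure R A)
    (h : ∀ (M : Type (max u v)) [AddCommGroup M] [Module R M] [Module A M] [Module Aᵐᵒᵖ M]
        [IsScalarTower R A M] [IsScalarTower R Aᵐᵒᵖ M] [SMulCommClass A Aᵐᵒᵖ M],
        Function.Bijective (invariantsEval R A M)) : IsAzumayaAlgebra R A :=
  { faithful := hi.faithful_comparison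
    full := full_comparison fun N _ _ => hi.bijective_toInvariants N (h (A ⊗[R] N)).1
    essSurj := essSurj_comparison h }

end Comparison

/-! ### The equivalence gives an Azumaya algebra -/

section DoubleCentralizer

variable {R : Type u} {A : Type v} [CommRing R] [Ring A] [Algebra R A]

theorem env_mul_invariant {z : A ⊗[R] Aᵐᵒᵖ} (hz : ∀ a : A, (a ⊗ₜ 1) * z = (1 ⊗ₜ op a) * z)
    (s : A ⊗[R] Aᵐᵒᵖ) : s * z = (AlgHom.mulLeftRight R A s 1 ⊗ₜ 1) * z := by
  induction s with
  | zero => simp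
  | add s t hs ht =>
    simp only [map_add, LinearMap.add_apply, add_mul, TensorProduct.add_tmul, hs, ht]
  | tmul x y =>
    have h1 : (x ⊗ₜ[R] y : A ⊗[R] Aᵐᵒᵖ) = (x ⊗ₜ 1) * (1 ⊗ₜ op (unop y)) := by simp
    rw [h1, mul_assoc, ← hz, ← mul_assoc]
    simp

/-- If the enveloping algebra is generated by its invariants and `R` is the centre of `A`, then
`A` is Azumaya. -/
theorem isAzumaya_of_sum_invariants (hinj : Function.Injective (algebraMap R A))
    (hcenter : ∀ c : A, (∀ a, a * c = c * a) → ∃ r, algebraMap R A r = c)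
    {n : ℕ} (a : Fin n → A) (z : Fin n → A ⊗[R] Aᵐᵒᵖ)
    (hz : ∀ i (a : A), (a ⊗ₜ 1) * z i = (1 ⊗ₜ op a) * z i)
    (hone : ∑ i, (a i ⊗ₜ 1) * z i = 1) : IsAzumaya R A := by
  -- Invariance of `z i` makes its values on `A` central.
  have hmem (i x) : AlgHom.mulLeftRight R A (z i) x ∈ LinearMap.range (Algebra.linearMap R A) := by
    refine hcenter _ fun b => ?_
    have := LinearMap.congr_fun (congrArg (AlgHom.mulLeftRight R A) (hz i b)) x
    simpa using this
  let f (i) : A →ₗ[R] R := (LinearEquiv.ofInjective (Algebra.linearMap R A) hinj).symm.toLinearMap ∘ₗ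
    (AlgHom.mulLeftRight R A (z i)).codRestrict _ (hmem i)
  have hf (i x) : algebraMap R A (f i x) = AlgHom.mulLeftRight R A (z i) x :=
    congrArg Subtype.val ((LinearEquiv.ofInjective (Algebra.linearMap R A) hinj).apply_symm_apply
      ⟨AlgHom.mulLeftRight R A (z i) x, hmem i x⟩)
  have hdual (x) : ∑ i, f i x • a i = x := by
    conv_rhs => rw [← Module.End.one_apply (R := R) x, ← map_one (AlgHom.mulLeftRight R A), ← hone,
      map_sum, LinearMap.sum_apply]
    refine Finset.sum_congr rfl fun i _ => ?_
    rw [map_mul, Module.End.mul_apply, ← hf]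
    simp [Algebra.smul_def, Algebra.commutes]
  obtain ⟨hfin, hproj⟩ := finite_projective_of_dual_basis a f hdual
  have : FaithfulSMul R A := (faithfulSMul_iff_algebraMap_injective R A).2 hinj
  -- Injectivity: if `w` acts as zero, then `w = ∑ w * (a i ⊗ 1) * z i`, and by `env_mul_invariant`
  -- each summand is `(w(a i) ⊗ 1) * z i = 0`.
  refine { bij := ⟨?_, fun φ => ⟨∑ i, (φ (a i) ⊗ₜ 1) * z i, ?_⟩⟩ }
  · rw [injective_iff_map_eq_zero]
    intro w hw
    rw [← mul_one w, ← hone, Finset.mul_sum]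
    refine Finset.sum_eq_zero fun i _ => ?_
    rw [← mul_assoc, env_mul_invariant (hz i), map_mul, hw, zero_mul, LinearMap.zero_apply,
      TensorProduct.zero_tmul, zero_mul]
  · ext x
    conv_rhs => rw [← hdual x, map_sum]
    rw [map_sum, LinearMap.sum_apply]
    refine Finset.sum_congr rfl fun i _ => ?_
    rw [map_mul, Module.End.mul_apply, ← hf, map_smul, Algebra.smul_def, Algebra.commutes]
    simp

/-- The inclusion of the kernel `K` of `n ↦ 1 ⊗ n` becomes zero after tensoring with `A`, so
faithfulness makes it zero. -/
theorem unitIsPure_of_faithful_comparison [(comparison R A).Faithful] : UnitIsPure R A := by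
  refine unitIsPure_of_eq_zero fun N _ _ n hn => ?_
  let K := LinearMap.ker (TensorProduct.mk R A N 1)
  have h0 : (comparison R A).map (ModuleCat.ofHom K.subtype) =
      (comparison R A).map (ModuleCat.ofHom 0) := by
    apply CategoryTheory.ConcreteCategory.hom_ext
    intro t
    change K.subtype.lTensor A t = (0 : K →ₗ[R] N).lTensor A t
    congr 1
    ext a k
    have hk : (1 : A) ⊗ₜ[R] (k : N) = 0 := k.2
    simpa [TensorProduct.smul_tmul'] using congrArg (a • ·) hk
  have h1 := congrArg ModuleCat.Hom.hom ((comparison R A).map_injective h0)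
  exact LinearMap.congr_fun h1 (⟨n, hn⟩ : K)

/-- Multiplication by a central `c` is a bimodule endomorphism of `A ≅ A ⊗ R`; by fullness it comes
from an endomorphism of `R`, that is, from a scalar. -/
theorem exists_algebraMap_eq_of_full_comparison [(comparison R A).Full] (c : A)
    (hc : ∀ a, a * c = c * a) : ∃ r, algebraMap R A r = c := by
  let _ := envModule R A (ULift.{v} R)
  let ψ : A ⊗[R] ULift.{v} R →ₗ[A ⊗[R] Aᵐᵒᵖ] A ⊗[R] ULift.{v} R :=
    { toFun := (LinearMap.mulLeft R c).rTensor _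
      map_add' := map_add _
      map_smul' := fun s t => by
        have hcomm : LinearMap.mulLeft R c ∘ₗ AlgHom.mulLeftRight R A s =
            AlgHom.mulLeftRight R A s ∘ₗ LinearMap.mulLeft R c := by
          induction s with
          | zero => simp
          | add s t hs ht => rw [map_add, LinearMap.comp_add, hs, ht, LinearMap.add_comp]
          | tmul x y => ext a; simp [← mul_assoc, hc]
        change (LinearMap.mulLeft R c).rTensor _ ((AlgHom.mulLeftRight R A s).rTensor _ t) =
          (AlgHom.mulLeftRight R A s).rTensor _ ((LinearMap.mulLeft R c).rTensor _ t)
        rw [← LinearMap.rTensor_comp_apply, hcomm, LinearMap.rTensor_comp_apply] }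
  obtain ⟨g, hg⟩ := (comparison R A).map_surjective
    (X := ModuleCat.of R (ULift.{v} R)) (Y := ModuleCat.of R (ULift.{v} R)) (ModuleCat.ofHom ψ)
  have h1 : (1 : A) ⊗ₜ[R] g.hom (ULift.up 1) = (c * 1) ⊗ₜ ULift.up 1 :=
    CategoryTheory.ConcreteCategory.congr_hom hg ((1 : A) ⊗ₜ[R] (ULift.up 1 : ULift.{v} R))
  refine ⟨(g.hom (ULift.up 1)).down, ?_⟩
  have h2 := congrArg (TensorProduct.rid R A ∘ (ULift.moduleEquiv (R := R)).toLinearMap.lTensor A) h1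
  simpa [Algebra.algebraMap_eq_smul_one] using h2

theorem exists_sum_invariants_of_essSurj_comparison [(comparison R A).EssSurj] :
    ∃ (n : ℕ) (a : Fin n → A) (z : Fin n → A ⊗[R] Aᵐᵒᵖ),
      (∀ i (a : A), (a ⊗ₜ 1) * z i = (1 ⊗ₜ op a) * z i) ∧ ∑ i, (a i ⊗ₜ 1) * z i = 1 := by
  let X : ModuleCat.{max u v} (A ⊗[R] Aᵐᵒᵖ) := ModuleCat.of _ (ULift.{u} (A ⊗[R] Aᵐᵒᵖ))
  let N := (comparison R A).objPreimage X
  let _ := envModule R A N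
  let e : A ⊗[R] N ≃ₗ[A ⊗[R] Aᵐᵒᵖ] A ⊗[R] Aᵐᵒᵖ :=
    ((comparison R A).objObjPreimageIso X).toLinearEquiv ≪≫ₗ ULift.moduleEquiv
  obtain ⟨t, ht⟩ := e.surjective 1
  obtain ⟨n, a, m, rfl⟩ := TensorProduct.exists_sum_tmul_eq t
  -- Each `1 ⊗ m i` is invariant in `A ⊗ N`, hence so is its image under the bimodule isomorphism
  -- `e`.
  refine ⟨n, a, fun i => e (1 ⊗ₜ m i), fun i b => ?_, ?_⟩
  · rw [← smul_eq_mul, ← smul_eq_mul, ← map_smul, ← map_smul, envModule_tmul_smul_tmul]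
    rw [← op_one, envModule_tmul_smul_tmul]
    simp
  · rw [← ht, map_sum]
    refine Finset.sum_congr rfl fun i _ => ?_
    rw [← smul_eq_mul, ← map_smul, ← op_one, envModule_tmul_smul_tmul]
    simp

theorem IsAzumayaAlgebra.isAzumaya (h : IsAzumayaAlgebra R A) : IsAzumaya R A := by
  have : (comparison R A).IsEquivalence := h
  obtain ⟨n, a, z, hz, hone⟩ := exists_sum_invariants_of_essSurj_comparison (R := R) (A := A)
  exact isAzumaya_of_sum_invariants unitIsPure_of_faithful_comparison.injective_algebraMap
    exists_algebraMap_eq_of_full_comparison a z hz hone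

theorem isAzumayaAlgebra_iff_isAzumaya : IsAzumayaAlgebra R A ↔ IsAzumaya R A :=
  ⟨IsAzumayaAlgebra.isAzumaya, fun _ => unitIsPure_of_isAzumaya.isAzumayaAlgebra
    fun M _ _ _ _ _ _ _ => bijective_invariantsEval M⟩

end DoubleCentralizer

end

end AzumayaAlgebra

theorem mainTheorem10 (R : Type u) (A : Type v) [CommRing R] [Ring A] [Algebra R A] :
    -- the definition through the comparison functor agrees with the usual one
    (AzumayaAlgebra.IsAzumayaAlgebra R A ↔ IsAzumaya R A) ∧
    -- (a)
    (AzumayaAlgebra.IsAzumayaAlgebra R A ↔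
      AzumayaAlgebra.UnitIsPure R A ∧
      ∀ (M : Type (max u v)) [AddCommGroup M] [Module R M] [Module Aᵐᵒᵖ M]
        [IsScalarTower R Aᵐᵒᵖ M],
        Function.Bijective (AzumayaAlgebra.opModuleMap R A M)) ∧
    -- (b)
    (AzumayaAlgebra.IsAzumayaAlgebra R A ↔
      AzumayaAlgebra.UnitIsPure R A ∧
      ∀ (N : Type (max u v)) [AddCommGroup N] [Module R N],
        Function.Bijective (AzumayaAlgebra.freeModuleMap R A N)) ∧
    -- (c)
    (AzumayaAlgebra.IsAzumayaAlgebra R A ↔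
      AzumayaAlgebra.UnitIsPure R A ∧
      Module.Finite R A ∧ Module.Projective R A ∧
        Function.Bijective (AzumayaAlgebra.sandwich R A)) ∧
    -- (d)
    (AzumayaAlgebra.IsAzumayaAlgebra R A ↔
      AzumayaAlgebra.UnitIsPure R A ∧
      ∀ (M : Type (max u v)) [AddCommGroup M] [Module R M] [Module A M] [Module Aᵐᵒᵖ M]
        [IsScalarTower R A M] [IsScalarTower R Aᵐᵒᵖ M] [SMulCommClass A Aᵐᵒᵖ M],
        Function.Bijective (AzumayaAlgebra.invariantsEval R A M)) := by
  have hAz := AzumayaAlgebra.isAzumayaAlgebra_iff_isAzumaya (R := R) (A := A)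
  refine ⟨hAz, hAz.trans ⟨fun _ => ⟨AzumayaAlgebra.unitIsPure_of_isAzumaya, fun M _ _ _ _ =>
      AzumayaAlgebra.bijective_opModuleMap M⟩, fun ⟨hi, h⟩ => ?_⟩,
    hAz.trans ⟨fun _ => ⟨AzumayaAlgebra.unitIsPure_of_isAzumaya, fun N _ _ => ?_⟩,
      fun ⟨hi, h⟩ => hi.isAzumaya_of_freeModuleMap h⟩,
    hAz.trans ⟨fun _ => ⟨AzumayaAlgebra.unitIsPure_of_isAzumaya, inferInstance, inferInstance,
      (AzumayaAlgebra.bijective_sandwich_iff R A).2 IsAzumaya.bij⟩,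
      fun ⟨hi, hf, hp, hs⟩ => hi.isAzumaya hf hp hs⟩,
    ⟨fun h => ?_, fun ⟨hi, h⟩ => hi.isAzumayaAlgebra h⟩⟩
  -- (a) implies (b) by taking `M = A ⊗ N`.
  · refine hi.isAzumaya_of_freeModuleMap fun N _ _ => ?_
    rw [← AzumayaAlgebra.opModuleMap_eq_freeModuleMap]
    exact h (A ⊗[R] N)
  · rw [← AzumayaAlgebra.opModuleMap_eq_freeModuleMap]
    exact AzumayaAlgebra.bijective_opModuleMap (A ⊗[R] N)
  · have := hAz.1 h
    exact ⟨AzumayaAlgebra.unitIsPure_of_isAzumaya, fun M _ _ _ _ _ _ _ =>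
      AzumayaAlgebra.bijective_invariantsEval M⟩
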